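/- Let $G=(V,\mathcal D,\mathcal B)$ be an acyclic directed mixed graph (finite vertex set $V$, directed edges $\to$, bidirected edges $\leftrightarrow$, no loops, no directed cycles). A vertex counts as its own ancestor and descendant; $\mathrm{an}(v)$, $\mathrm{de}(v)$, $\mathrm{pa}(S)$ denote ancestors of $v$, descendants of $v$, and parents of vertices of $S$ in $G$, and $G_S$ is the induced subgraph on $S$. In a given graph, the district $\mathrm{dis}(v)$ is the set of vertices joined to $v$ by a bidirected path (including $v$), the Markov blanket of $v$ is $\mathrm{mb}(v)=\mathrm{pa}(\mathrm{dis}(v))\cup(\mathrm{dis}(v)\setminus\{v\})$, and $v$ is fixable if $\mathrm{de}(v)\cap\mathrm{dis}(v)=\{v\}$. Write $G^{(d)}_{b\to c}$ for the induced subgraph on $\mathrm{an}(c)\cap\mathrm{de}(b)$ with all bidirected edges removed; a vertex $v$ of it is a cut vertex if $G^{(d)}_{b\to c}-\{v\}$ is disconnected (as an undirected graph). The Gaussian linear structural equation model of $G$ has parameters $(\Lambda,\Omega)$, where $\Lambda=(\lambda_{ij})$ is a real $V\times V$ matrix with $\lambda_{ij}\ne0$ only if $i\to j\in\mathcal D$,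 and $\Omega=(\omega_{ij})$ is a real symmetric positive definite $V\times V$ matrix with $\omega_{ij}\neq 0$ only if $i=j$ or $i\leftrightarrow j\in\mathcal B$. Its distribution is $N(0,\Sigma)$ with $\Sigma=(I-\Lambda)^{-T}\Omega(I-\Lambda)^{-1}$. Let $a^*\to b$ be a directed edge of $G$, let $G^*$ be $G$ with this edge removed, and let $\Sigma^*=(I-\Lambda^*)^{-T}\Omega(I-\Lambda^*)^{-1}$, where $\Lambda^*$ is $\Lambda$ with the entry $\lambda_{a^*b}$ replaced by $0$. Suppose that 1. $a^*$ is not in the Markov blanket of $b$ in $G^*_{\mathrm{an}(b)}$, the induced subgraph of $G^*$ on the set $\mathrm{an}(b)$ of ancestors of $b$ in $G$; and 2. for every $c\in\mathrm{de}(b)\setminus\{b\}$ there are vertices $v_0=b,v_1,\dots,v_n=c$ such that $v_1,\dots,v_{n-1}$ are cut vertices of $G^{(d)}_{b\to c}$ and, for all $0\le i\le n-1$, $v_i$ is a vertex of $G_{\mathrm{an}(v_{i+1})}$ and is fixable in $G_{\mathrm{an}(v_{i+1})}$. Then $\Sigma^*$ is identifiable given $\Sigma$: any two parameters $(\Lambda,\Omega)$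 and $(\Lambda',\Omega')$ of the model of $G$ with the same covariance matrix $\Sigma$ also have the same $\Sigma^*$. -/

import Mathlib

/-- An acyclic directed mixed graph with vertex set `V`: `G.dir x y` is the directed edge `x → y`,
`G.bidir.Adj x y` is the bidirected edge `x ↔ y`. There are no loops (for directed edges this is
part of acyclicity), and two vertices may be joined by edges of both kinds. -/
@[ext]
structure ADMG (V : Type*) where
  dir : V → V → Prop
  bidir : SimpleGraph V
  acyclic : ∀ v, ¬ Relation.TransGen dir v v

namespace ADMG

variable {V : Type*}

/-- Parents of the vertices in `S`. -/
def pa (G : ADMG V) (S : Set V) : Set V := {x | ∃ y ∈ S, G.dir x y}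

/-- Ancestors of `v`, including `v`. -/
def an (G : ADMG V) (v : V) : Set V := {u | Relation.ReflTransGen G.dir u v}

/-- Descendants of `v`, including `v`. -/
def de (G : ADMG V) (v : V) : Set V := {u | Relation.ReflTransGen G.dir v u}

/-- The district of `v`: all vertices joined to `v` by a bidirected path. -/
def dis (G : ADMG V) (v : V) : Set V := {u | G.bidir.Reachable v u}

/-- The Markov blanket of `v`. -/
def mb (G : ADMG V) (v : V) : Set V := G.pa (G.dis v) ∪ (G.dis v \ {v})

/-- `v` is fixable if no other vertex is both a descendant of `v` and in its district. -/
def Fixable (G : ADMG V) (v : V) : Prop := G.de v ∩ G.dis v = {v}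

/-- The induced subgraph on the vertex set `S`. -/
def induce (G : ADMG V) (S : Set V) : ADMG S where
  dir x y := G.dir x y
  bidir := G.bidir.induce S
  acyclic v h := G.acyclic v (Relation.TransGen.lift (p := G.dir) Subtype.val (fun _ _ h => h) _ _ h)

/-- The graph with all bidirected edges removed. -/
def directedPart (G : ADMG V) : ADMG V where
  dir := G.dir
  bidir := ⊥
  acyclic := G.acyclic

/-- The graph obtained by removing the directed edge `a → b`. -/
def removeEdge (G : ADMG V) (a b : V) : ADMG V where
  dir x y := G.dir x y ∧ ¬ (x = a ∧ y = b)
  bidir := G.bidir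
  acyclic v h := G.acyclic v (Relation.TransGen.mono (fun _ _ h => h.1) _ _ h)

/-- The underlying undirected graph. -/
def skeleton (G : ADMG V) : SimpleGraph V := SimpleGraph.fromRel G.dir ⊔ G.bidir

/-- `v` is a cut vertex if the graph becomes disconnected when `v` is removed. -/
def IsCutVertex (G : ADMG V) (v : V) : Prop := ¬ (G.induce {v}ᶜ).skeleton.Preconnected

/-- The induced subgraph on `an(c) ∩ de(b)` with all bidirected edges removed. -/
def between (G : ADMG V) (b c : V) : ADMG ↥(G.an c ∩ G.de b) :=
  (G.induce (G.an c ∩ G.de b)).directedPart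

/-- `v` is a vertex of the induced subgraph on `S`, and it is fixable there. -/
def FixableIn (G : ADMG V) (S : Set V) (v : V) : Prop :=
  ∃ h : v ∈ S, (G.induce S).Fixable ⟨v, h⟩

/-- The Markov blanket of `v` in the induced subgraph on `S`, as a set of vertices of `G`. -/
def mbIn (G : ADMG V) (S : Set V) (v : V) : Set V :=
  {u | ∃ (hu : u ∈ S) (hv : v ∈ S), (⟨u, hu⟩ : S) ∈ (G.induce S).mb ⟨v, hv⟩}

/-- `v` is a vertex of `G.between b c`, and it is a cut vertex there. -/
def IsCutVertexBetween (G : ADMG V) (b c v : V) : Prop :=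
  ∃ h : v ∈ G.an c ∩ G.de b, (G.between b c).IsCutVertex ⟨v, h⟩

/-- The parameters of the Gaussian linear structural equation model
`X_j = ∑ i ∈ pa(j), lam i j * X_i + ε_j`, `ε ∼ N(0, Ω)`, of the graph `G`. -/
structure Param (G : ADMG V) where
  /-- edge coefficients: `lam i j` belongs to `i → j` -/
  lam : Matrix V V ℝ
  /-- covariance matrix of the errors -/
  om : Matrix V V ℝ
  lam_support : ∀ i j, lam i j ≠ 0 → G.dir i j
  om_support : ∀ i j, om i j ≠ 0 → i = j ∨ G.bidir.Adj i j
  om_posDef : om.PosDef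

/-- The covariance matrix `(I - Λ)⁻ᵀ Ω (I - Λ)⁻¹` of `X`. -/
noncomputable def Param.cov [Fintype V] [DecidableEq V] {G : ADMG V} (θ : G.Param) :
    Matrix V V ℝ :=
  ((1 - θ.lam)⁻¹).transpose * θ.om * (1 - θ.lam)⁻¹

/-- Removing the directed edge `a → b` from the model: its coefficient becomes `0` and all other
parameters stay the same. -/
def Param.removeEdge [DecidableEq V] {G : ADMG V} (θ : G.Param) (a b : V) :
    (G.removeEdge a b).Param where
  lam := Matrix.of fun i j => if i = a ∧ j = b then 0 else θ.lam i j
  om := θ.om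
  lam_support i j h := by
    by_cases hij : i = a ∧ j = b
    · simp [hij] at h
    · exact ⟨θ.lam_support i j (by simpa [hij] using h), hij⟩
  om_support := θ.om_support
  om_posDef := θ.om_posDef

end ADMG

/-- The quantity `ψ` is (globally) identifiable from the quantity `φ` over the parameter space
`Θ`: parameters with the same value of `φ` have the same value of `ψ`. For `ψ = id` this says that
`φ` is one-to-one on `Θ`. -/
def IdentifiableGiven {Θ M N : Type*} (ψ : Θ → N) (φ : Θ → M) : Prop :=
  ∀ θ θ' : Θ, φ θ = φ θ' → ψ θ = ψ θ'

/-! Let T = (I - Λ)⁻¹ be the matrix of total effects. Deleting a → b changes I - Λ by a rank-one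
matrix, so Σ* is a congruence of Σ by a matrix built from λ_ab and row b of T alone
(`cov_removeEdge`). It suffices that Σ determines these.

The engine is `totalEffect_and_lam_eq_of_cov_eq`. In an ancestral set A where v is fixable with
district D, take the residual of ε_v given the other errors of D and write it as a combination w of
the variables X. Then w lives on v and its Markov blanket, and Σw = s T_v on A, which vanishes on
the blanket. Positive definiteness makes w unique, so Σ determines s and T_vx for x in A. Moreover
w_a = -λ_av if a is outside D and a parent of no vertex of D but possibly v.

This gives λ_ab with A = an(b), and T_vc for v fixable in an(c). Since cut vertices block all
directed paths, T_bc is the product of such effects along the chain. -/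

namespace ADMG

open Matrix Relation

/-! ### Directed paths, cut vertices and districts. -/

section Order

variable {V : Type*} (G : ADMG V)

theorem dir_wellFounded [Finite V] : WellFounded G.dir := by
  have : Std.Irrefl (TransGen G.dir) := ⟨G.acyclic⟩
  have : IsTrans V (TransGen G.dir) := ⟨fun _ _ _ => TransGen.trans⟩
  exact Subrelation.wf (fun h => TransGen.single h)
    (Finite.wellFounded_of_trans_of_irrefl (TransGen G.dir))

theorem reach_antisymm {x y : V} (h : ReflTransGen G.dir x y) (h' : ReflTransGen G.dir y x) :
    x = y := by
  rcases reflTransGen_iff_eq_or_transGen.1 h with rfl | h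
  · rfl
  · exact (G.acyclic x (h.trans_left h')).elim

/-- Every directed path avoids a vertex that does not lie between its ends. -/
theorem reach_avoiding {v x y : V} (h : ReflTransGen G.dir x y)
    (hv : ¬ (ReflTransGen G.dir x v ∧ ReflTransGen G.dir v y)) :
    ReflTransGen (fun x y => G.dir x y ∧ y ≠ v) x y := by
  induction h using ReflTransGen.head_induction_on with
  | refl => exact .refl
  | head hxz hzy ih =>
    refine .head ⟨hxz, ?_⟩ (ih fun h => hv ⟨.head hxz h.1, h.2⟩)
    rintro rfl
    exact hv ⟨.single hxz, hzy⟩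

/-- A directed path between two vertices of an(c) ∩ de(b) never leaves this set, so it survives in
the induced subgraph. -/
theorem reachable_of_reach_avoiding {b c : V} {v : ↥(G.an c ∩ G.de b)} {x y : V}
    (h : ReflTransGen (fun x y => G.dir x y ∧ y ≠ v.1) x y)
    (hx : x ∈ G.an c ∩ G.de b) (hxv : (⟨x, hx⟩ : ↥(G.an c ∩ G.de b)) ∈ ({v}ᶜ : Set _))
    (hy : y ∈ G.an c ∩ G.de b) (hyv : (⟨y, hy⟩ : ↥(G.an c ∩ G.de b)) ∈ ({v}ᶜ : Set _)) :
    (((G.between b c).induce {v}ᶜ).skeleton).Reachable ⟨⟨x, hx⟩, hxv⟩ ⟨⟨y, hy⟩, hyv⟩ := by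
  induction h using ReflTransGen.head_induction_on with
  | refl => exact .refl _
  | @head x z hxz hzy ih =>
    have hz : z ∈ G.an c ∩ G.de b :=
      ⟨ReflTransGen.trans (ReflTransGen.mono (fun _ _ h => h.1) _ _ hzy) hy.1, ReflTransGen.tail hx.2 hxz.1⟩
    have hzv : (⟨z, hz⟩ : ↥(G.an c ∩ G.de b)) ∈ ({v}ᶜ : Set _) :=
      fun h => hxz.2 (congrArg Subtype.val h)
    refine .trans (SimpleGraph.Adj.reachable ?_) (ih hz hzv)
    refine Or.inl ⟨fun h => ?_, Or.inl hxz.1⟩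
    have hxz' : x = z := congrArg (fun u => u.1.1) h
    exact G.acyclic z (.single (by simpa only [hxz'] using hxz.1))

/-- A cut vertex meets every directed path from `b` to `c`. -/
theorem IsCutVertexBetween.not_reach_avoiding {G : ADMG V} {b c v : V} (hbc : b ≠ c)
    (h : G.IsCutVertexBetween b c v) :
    b ≠ v ∧ ¬ ReflTransGen (fun x y => G.dir x y ∧ y ≠ v) b c := by
  obtain ⟨hv, hcut⟩ := h
  have hbH : b ∈ G.an c ∩ G.de b := ⟨ReflTransGen.trans hv.2 hv.1, ReflTransGen.refl⟩
  have hcH : c ∈ G.an c ∩ G.de b := ⟨ReflTransGen.refl, ReflTransGen.trans hv.2 hv.1⟩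
  have ne_of {x : V} {hx : x ∈ G.an c ∩ G.de b} (hxv : x ≠ v) :
      (⟨x, hx⟩ : ↥(G.an c ∩ G.de b)) ∈ ({⟨v, hv⟩}ᶜ : Set _) :=
    fun h => hxv (congrArg Subtype.val h)
  have hbv : b ≠ v := by
    rintro rfl
    refine hcut fun x y => ?_
    -- Deleting b never disconnects: by acyclicity every other vertex still reaches c.
    have key (u : ↥({⟨b, hv⟩}ᶜ : Set ↥(G.an c ∩ G.de b))) :
        (((G.between b c).induce {⟨b, hv⟩}ᶜ).skeleton).Reachable u
          ⟨⟨c, hcH⟩, ne_of hbc.symm⟩ :=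
      G.reachable_of_reach_avoiding (G.reach_avoiding u.1.2.1 fun h =>
        u.2 (Subtype.ext (G.reach_antisymm h.1 (show ReflTransGen G.dir b u.1.1 from u.1.2.2)))) _ u.2 _ _
    exact (key x).trans (key y).symm
  refine ⟨hbv, fun hR => hcut fun x y => ?_⟩
  have hcv : c ≠ v := by
    rintro rfl
    rcases ReflTransGen.cases_tail hR with h | ⟨z, -, hz⟩
    · exact hbc h.symm
    · exact hz.2 rfl
  have hcb := G.reachable_of_reach_avoiding (v := ⟨v, hv⟩) hR hbH (ne_of hbv) hcH (ne_of hcv)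
  -- Vertices below v reach c off v, the others are reached from b off v, and the assumed path joins
  -- b to c.
  have key (u : ↥({⟨v, hv⟩}ᶜ : Set ↥(G.an c ∩ G.de b))) :
      (((G.between b c).induce {⟨v, hv⟩}ᶜ).skeleton).Reachable u ⟨⟨c, hcH⟩, ne_of hcv⟩ := by
    by_cases hvu : ReflTransGen G.dir v u.1.1
    · exact G.reachable_of_reach_avoiding (G.reach_avoiding u.1.2.1 fun h =>
        u.2 (Subtype.ext (G.reach_antisymm h.1 hvu))) _ u.2 _ _
    · exact (G.reachable_of_reach_avoiding (G.reach_avoiding u.1.2.2 fun h => hvu h.2)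
        hbH (ne_of hbv) _ u.2).symm.trans hcb
  exact (key x).trans (key y).symm

/-- A cut vertex meets every directed path from `b` to an intermediate vertex below it. -/
theorem IsCutVertexBetween.not_reach_avoiding_of_mem_an {G : ADMG V} {b c v x : V} (hbc : b ≠ c)
    (h : G.IsCutVertexBetween b c v) (hvx : v ∈ G.an x) (hxv : x ≠ v) (hxc : x ∈ G.an c) :
    ¬ ReflTransGen (fun x y => G.dir x y ∧ y ≠ v) b x := fun hR =>
  (h.not_reach_avoiding hbc).2 <| hR.trans <| G.reach_avoiding hxc fun h =>
    hxv (G.reach_antisymm h.1 hvx)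

/-- The district of `v` in the induced subgraph on `S`, as a set of vertices of `G`. -/
def disIn (S : Set V) (v : V) : Set V :=
  {u | ∃ (hu : u ∈ S) (hv : v ∈ S), (⟨u, hu⟩ : S) ∈ (G.induce S).dis ⟨v, hv⟩}

theorem mem_disIn_self {S : Set V} {v : V} (hv : v ∈ S) : v ∈ G.disIn S v :=
  ⟨hv, hv, .refl _⟩

theorem mem_disIn_of_adj {S : Set V} {v x y : V} (hx : x ∈ G.disIn S v) (hy : y ∈ S)
    (h : G.bidir.Adj x y) : y ∈ G.disIn S v := by
  obtain ⟨hxS, hv, hx⟩ := hx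
  exact ⟨hy, hv, hx.trans (SimpleGraph.Adj.reachable (by exact h))⟩

theorem induce_reach_of_reach {S : Set V} (hS : ∀ x y, G.dir x y → y ∈ S → x ∈ S) {x y : V}
    (h : ReflTransGen G.dir x y) (hx : x ∈ S) (hy : y ∈ S) :
    ReflTransGen (G.induce S).dir ⟨x, hx⟩ ⟨y, hy⟩ := by
  induction h with
  | refl => exact .refl
  | tail _ hzy ih => exact ReflTransGen.tail (ih (hS _ _ hzy hy)) hzy

theorem FixableIn.eq_of_reach {G : ADMG V} {S : Set V} {v : V} (h : G.FixableIn S v)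
    (hS : ∀ x y, G.dir x y → y ∈ S → x ∈ S) {x : V} (hx : x ∈ G.disIn S v)
    (hvx : ReflTransGen G.dir v x) : x = v := by
  obtain ⟨hv, h⟩ := h
  obtain ⟨hxS, _, hx⟩ := hx
  have : (⟨x, hxS⟩ : S) ∈ (G.induce S).de ⟨v, hv⟩ ∩ (G.induce S).dis ⟨v, hv⟩ :=
    ⟨G.induce_reach_of_reach hS hvx hv hxS, hx⟩
  rw [h] at this
  exact congrArg Subtype.val this

end Order

/-! ### Total effects and residuals. -/

namespace Param

variable {V : Type*} [Fintype V] [DecidableEq V] {G : ADMG V} (θ : G.Param)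

theorem isUnit_one_sub_lam : IsUnit (1 - θ.lam) := by
  rw [← Matrix.vecMul_injective_iff_isUnit]
  refine (injective_iff_map_eq_zero (Matrix.vecMulLinear (1 - θ.lam))).2 fun x hx => ?_
  have hx' : x = x ᵥ* θ.lam := by
    have : x ᵥ* (1 - θ.lam) = 0 := hx
    rwa [Matrix.vecMul_sub, Matrix.vecMul_one, sub_eq_zero] at this
  funext j
  induction j using G.dir_wellFounded.induction with
  | _ j ih =>
    rw [hx']
    refine Finset.sum_eq_zero fun i _ => ?_
    change x i * θ.lam i j = 0
    by_cases h : θ.lam i j = 0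
    · rw [h, mul_zero]
    · rw [ih i (θ.lam_support i j h), Pi.zero_apply, zero_mul]

/-- The matrix `(I - Λ)⁻¹` of total effects. -/
noncomputable def totalEffect : Matrix V V ℝ := (1 - θ.lam)⁻¹

theorem totalEffect_mul_one_sub : θ.totalEffect * (1 - θ.lam) = 1 :=
  Matrix.nonsing_inv_mul _ ((Matrix.isUnit_iff_isUnit_det _).1 θ.isUnit_one_sub_lam)

theorem one_sub_mul_totalEffect : (1 - θ.lam) * θ.totalEffect = 1 :=
  Matrix.mul_nonsing_inv _ ((Matrix.isUnit_iff_isUnit_det _).1 θ.isUnit_one_sub_lam)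

theorem cov_eq : θ.cov = θ.totalEffectᵀ * θ.om * θ.totalEffect := rfl

theorem totalEffect_apply (x y : V) :
    θ.totalEffect x y = (1 : Matrix V V ℝ) x y + ∑ z, θ.totalEffect x z * θ.lam z y := by
  have h := congrFun (congrFun θ.totalEffect_mul_one_sub x) y
  rw [mul_sub, mul_one, Matrix.sub_apply, sub_eq_iff_eq_add] at h
  rw [h, Matrix.mul_apply]

theorem totalEffect_eq_zero {x y : V} (h : ¬ ReflTransGen G.dir x y) :
    θ.totalEffect x y = 0 := by
  induction y using G.dir_wellFounded.induction with
  | _ y ih =>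
    rw [totalEffect_apply, Matrix.one_apply_ne (by rintro rfl; exact h .refl), zero_add]
    refine Finset.sum_eq_zero fun z _ => ?_
    by_cases hz : θ.lam z y = 0
    · rw [hz, mul_zero]
    · rw [ih z (θ.lam_support z y hz) fun hxz => h (hxz.tail (θ.lam_support z y hz)), zero_mul]

theorem totalEffect_self (x : V) : θ.totalEffect x x = 1 := by
  rw [totalEffect_apply, Matrix.one_apply_eq, add_eq_left]
  refine Finset.sum_eq_zero fun z _ => ?_
  by_cases hz : θ.lam z x = 0
  · rw [hz, mul_zero]
  · rw [θ.totalEffect_eq_zero fun h => G.acyclic x (TransGen.tail' h (θ.lam_support z x hz)),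
      zero_mul]

/-- Total effects multiply along a vertex that meets all directed paths. -/
theorem totalEffect_eq_mul {b v x : V}
    (h : x = v ∨ ¬ ReflTransGen (fun x y => G.dir x y ∧ y ≠ v) b x) :
    θ.totalEffect b x = θ.totalEffect b v * θ.totalEffect v x := by
  induction x using G.dir_wellFounded.induction with
  | _ x ih =>
    by_cases hxv : x = v
    · rw [hxv, totalEffect_self, mul_one]
    have hR := h.resolve_left hxv
    -- For x ≠ v both sides obey the same recursion over the parents of x, and the hypothesis passes
    -- to each parent.
    rw [totalEffect_apply, θ.totalEffect_apply v x, Matrix.one_apply_ne (Ne.symm hxv),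
      Matrix.one_apply_ne (by rintro rfl; exact hR .refl), zero_add, zero_add, Finset.mul_sum]
    refine Finset.sum_congr rfl fun z _ => ?_
    by_cases hz : θ.lam z x = 0
    · rw [hz, mul_zero, mul_zero, mul_zero]
    · have hzx := θ.lam_support z x hz
      rw [ih z hzx (Or.inr fun h => hR (h.tail ⟨hzx, hxv⟩)), mul_assoc]

theorem cov_posDef : θ.cov.PosDef := by
  rw [cov_eq, ← Matrix.conjTranspose_eq_transpose_of_trivial]
  refine θ.om_posDef.conjTranspose_mul_mul_same ?_
  rw [Matrix.mulVec_injective_iff_isUnit]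
  exact ⟨⟨_, _, θ.totalEffect_mul_one_sub, θ.one_sub_mul_totalEffect⟩, rfl⟩

/-- The coefficients of the residual of `ε_v` given the other errors with index in `D`. -/
theorem exists_error_residual {D : Set V} {v : V} (hv : v ∈ D) :
    ∃ (α : V → ℝ) (s : ℝ), s ≠ 0 ∧ α v = 1 ∧ (∀ x ∉ D, α x = 0) ∧
      (θ.om *ᵥ α) v = s ∧ ∀ x ∈ D, x ≠ v → (θ.om *ᵥ α) x = 0 := by
  classical
  let B : Matrix D D ℝ := θ.om.submatrix Subtype.val Subtype.val
  have hB : B.PosDef := θ.om_posDef.submatrix Subtype.val_injective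
  have ht : 0 < B⁻¹ ⟨v, hv⟩ ⟨v, hv⟩ := hB.inv.diag_pos
  set t := B⁻¹ ⟨v, hv⟩ ⟨v, hv⟩ with ht_def
  -- Column v of the precision matrix of the errors in D, scaled to be 1 at v; the residual variance
  -- is then 1 / t.
  let α : V → ℝ := fun x => if hx : x ∈ D then B⁻¹ ⟨x, hx⟩ ⟨v, hv⟩ / t else 0
  have hα (x : D) : α x = B⁻¹ x ⟨v, hv⟩ / t := by simp [α]
  have hom (x : D) : (θ.om *ᵥ α) x = (1 : Matrix D D ℝ) x ⟨v, hv⟩ / t := by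
    have h1 : (θ.om *ᵥ α) x = ∑ y : D, θ.om x y * α y := by
      refine (Finset.sum_subset (Finset.subset_univ D.toFinset) fun y _ hy => by
          rw [show α y = 0 from dif_neg fun h => hy (Set.mem_toFinset.2 h), mul_zero]).symm.trans ?_
      exact Finset.sum_subtype _ (fun y => Set.mem_toFinset) fun y => θ.om x y * α y
    rw [h1, ← Matrix.mul_nonsing_inv B ((Matrix.isUnit_iff_isUnit_det _).1 hB.isUnit),
      Matrix.mul_apply, Finset.sum_div]
    exact Finset.sum_congr rfl fun y _ => by rw [hα, mul_div_assoc]; rfl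
  refine ⟨α, 1 / t, by positivity, ?_, fun x hx => dif_neg hx, ?_, fun x hx hxv => ?_⟩
  · rw [hα ⟨v, hv⟩, div_self ht.ne']
  · rw [hom ⟨v, hv⟩, Matrix.one_apply_eq]
  · rw [hom ⟨x, hx⟩, Matrix.one_apply_ne (fun h => hxv (congrArg Subtype.val h)), zero_div]

section Residual

variable {A D : Set V} {v : V}

/-- The coefficients of the residual of `X_v` given its Markov blanket. -/
theorem exists_residual (hA : ∀ x y, G.dir x y → y ∈ A → x ∈ A) (hv : v ∈ D)
    (hD : ∀ x ∈ D, ∀ y ∈ A, G.bidir.Adj x y → y ∈ D)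
    (hfix : ∀ x ∈ D, ReflTransGen G.dir v x → x = v) :
    ∃ (w : V → ℝ) (s : ℝ), s ≠ 0 ∧ w v = 1 ∧ (∀ x ∉ D, x ∉ G.pa D → w x = 0) ∧
      (∀ x ∈ A, (θ.cov *ᵥ w) x = s * θ.totalEffect v x) ∧
      (∀ a ∉ D, (∀ y ∈ D, y ≠ v → ¬ G.dir a y) → w a = - θ.lam a v) := by
  obtain ⟨α, s, hs, hα1, hα0, hαv, hαD⟩ := θ.exists_error_residual hv
  have hw (x : V) : ((1 - θ.lam) *ᵥ α) x = α x - ∑ y, θ.lam x y * α y := by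
    rw [Matrix.sub_mulVec, Matrix.one_mulVec]; rfl
  refine ⟨(1 - θ.lam) *ᵥ α, s, hs, ?_, fun x hxD hxp => ?_, fun x hx => ?_, fun a ha hay => ?_⟩
  · rw [hw, hα1, sub_eq_self]
    refine Finset.sum_eq_zero fun y _ => ?_
    by_cases hy : y ∈ D
    · by_contra hne
      have hd := θ.lam_support v y (left_ne_zero_of_mul hne)
      have := hfix y hy (.single hd)
      exact G.acyclic v (.single (this ▸ hd))
    · rw [hα0 y hy, mul_zero]
  · rw [hw, hα0 x hxD, zero_sub, neg_eq_zero]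
    refine Finset.sum_eq_zero fun y _ => ?_
    by_cases hy : y ∈ D
    · by_contra hne
      exact hxp ⟨y, hy, θ.lam_support x y (left_ne_zero_of_mul hne)⟩
    · rw [hα0 y hy, mul_zero]
  · have hAan {y : V} (h : ReflTransGen G.dir y x) : y ∈ A := by
      induction h using ReflTransGen.head_induction_on with
      | refl => exact hx
      | head h _ ih => exact hA _ _ h ih
    -- Σ(I - Λ)α = TᵀΩα. Only the term at v survives: Ωα vanishes on the rest of D by choice of α
    -- and on A \ D because D is closed under bidirected edges in A, while vertices outside A have
    -- no effect on x.
    rw [cov_eq, Matrix.mulVec_mulVec, mul_assoc, totalEffect_mul_one_sub, mul_one,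
      ← Matrix.mulVec_mulVec]
    rw [Matrix.mulVec, dotProduct, Finset.sum_eq_single v]
    · rw [hαv, mul_comm]; rfl
    · intro y _ hyv
      by_cases hyx : ReflTransGen G.dir y x
      · have hyA := hAan hyx
        by_cases hyD : y ∈ D
        · rw [hαD y hyD hyv, mul_zero]
        · have : (θ.om *ᵥ α) y = 0 := by
            refine Finset.sum_eq_zero fun z _ => ?_
            by_cases hz : z ∈ D
            · by_contra hne
              rcases θ.om_support y z (left_ne_zero_of_mul hne) with rfl | h
              · exact hyD hz
              · exact hyD (hD z hz y hyA h.symm)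
            · rw [hα0 z hz, mul_zero]
          rw [this, mul_zero]
      · rw [Matrix.transpose_apply, θ.totalEffect_eq_zero hyx, zero_mul]
    · simp
  · rw [hw, hα0 a ha, zero_sub, neg_inj, Finset.sum_eq_single v]
    · rw [hα1, mul_one]
    · intro y _ hyv
      by_cases hy : y ∈ D
      · by_contra hne
        exact hay y hy hyv (θ.lam_support a y (left_ne_zero_of_mul hne))
      · rw [hα0 y hy, mul_zero]
    · simp

theorem totalEffect_and_lam_eq_of_cov_eq {θ θ' : G.Param} (hcov : θ.cov = θ'.cov)
    (hA : ∀ x y, G.dir x y → y ∈ A → x ∈ A) (hv : v ∈ D) (hDA : D ⊆ A)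
    (hD : ∀ x ∈ D, ∀ y ∈ A, G.bidir.Adj x y → y ∈ D)
    (hfix : ∀ x ∈ D, ReflTransGen G.dir v x → x = v) :
    (∀ x ∈ A, θ.totalEffect v x = θ'.totalEffect v x) ∧
      ∀ a ∉ D, (∀ y ∈ D, y ≠ v → ¬ G.dir a y) → θ.lam a v = θ'.lam a v := by
  obtain ⟨w, s, hs, hw1, hw0, hwT, hwl⟩ := θ.exists_residual hA hv hD hfix
  obtain ⟨w', s', -, hw1', hw0', hwT', hwl'⟩ := θ'.exists_residual hA hv hD hfix
  rw [← hcov] at hwT'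
  have hblanket {x : V} (hx : x ∈ D ∨ x ∈ G.pa D) (hxv : x ≠ v) :
      x ∈ A ∧ ¬ ReflTransGen G.dir v x := by
    rcases hx with hx | ⟨y, hy, hxy⟩
    · exact ⟨hDA hx, fun h => hxv (hfix x hx h)⟩
    · refine ⟨hA _ _ hxy (hDA hy), fun h => ?_⟩
      have := hfix y hy (h.tail hxy)
      exact G.acyclic v (TransGen.tail' h (this ▸ hxy))
  -- The difference w - w' is supported on the blanket without v, where Σw and Σw' both vanish since
  -- no blanket vertex descends from v. Its quadratic form is therefore 0.
  have hww : w = w' := by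
    by_contra hne
    have hpos := θ.cov_posDef.dotProduct_mulVec_pos (sub_ne_zero.2 hne)
    refine hpos.ne' (Finset.sum_eq_zero fun x _ => ?_)
    by_cases hx : x ∈ D ∨ x ∈ G.pa D
    · by_cases hxv : x = v
      · simp [hxv, hw1, hw1']
      · obtain ⟨hxA, hvx⟩ := hblanket hx hxv
        rw [Matrix.mulVec_sub, Pi.sub_apply, hwT x hxA, hwT' x hxA, θ.totalEffect_eq_zero hvx,
          θ'.totalEffect_eq_zero hvx]
        simp
    · rw [not_or] at hx
      simp [hw0 x hx.1 hx.2, hw0' x hx.1 hx.2]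
  subst hww
  have hss : s = s' := by
    have h := (hwT v (hDA hv)).symm.trans (hwT' v (hDA hv))
    simpa [totalEffect_self] using h
  subst hss
  refine ⟨fun x hx => mul_left_cancel₀ hs ((hwT x hx).symm.trans (hwT' x hx)), fun a ha hay => ?_⟩
  exact neg_injective ((hwl a ha hay).symm.trans (hwl' a ha hay))

end Residual

/-! ### Removing a directed edge. -/

section RemoveEdge

variable {a b : V}

/-- This is the Sherman–Morrison formula; its denominator is 1 because b has no effect on its parent
a. -/
theorem totalEffect_removeEdge (hab : G.dir a b) :
    (θ.removeEdge a b).totalEffect = θ.totalEffect *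
      (1 - θ.lam a b • Matrix.vecMulVec (Pi.single a 1) (θ.totalEffect b)) := by
  refine Matrix.inv_eq_right_inv ?_
  have hlam : 1 - (θ.removeEdge a b).lam =
      (1 - θ.lam) + θ.lam a b • Matrix.vecMulVec (Pi.single a 1) (Pi.single b 1) := by
    ext i j
    by_cases hi : i = a <;> by_cases hj : j = b <;>
      simp [removeEdge, Matrix.vecMulVec_apply, hi, hj]
  have hb : Pi.single b 1 ᵥ* θ.totalEffect = θ.totalEffect b := Matrix.single_one_vecMul _ _
  have hba : θ.totalEffect b ⬝ᵥ Pi.single a 1 = 0 := by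
    rw [dotProduct_single_one]
    exact θ.totalEffect_eq_zero fun h => G.acyclic b (TransGen.tail' h hab)
  rw [hlam, ← mul_assoc, add_mul, one_sub_mul_totalEffect, smul_mul_assoc, Matrix.vecMulVec_mul,
    hb, add_mul, one_mul, mul_sub, mul_one, smul_mul_smul_comm, Matrix.vecMulVec_mul_vecMulVec,
    hba]
  simp

theorem cov_removeEdge (hab : G.dir a b) :
    (θ.removeEdge a b).cov =
      (1 - θ.lam a b • Matrix.vecMulVec (Pi.single a 1) (θ.totalEffect b))ᵀ * θ.cov *
        (1 - θ.lam a b • Matrix.vecMulVec (Pi.single a 1) (θ.totalEffect b)) := by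
  rw [cov_eq, cov_eq, totalEffect_removeEdge θ hab, Matrix.transpose_mul]
  simp only [mul_assoc]
  rfl

end RemoveEdge

end Param

/-! ### Identification of the edge coefficient and the total effects. -/

theorem dir_mem_an (G : ADMG V) {c x y : V} (h : G.dir x y) (hy : y ∈ G.an c) : x ∈ G.an c :=
  ReflTransGen.head h hy

theorem FixableIn.totalEffect_eq [Fintype V] [DecidableEq V] {G : ADMG V} {v c : V}
    (h : G.FixableIn (G.an c) v) {θ θ' : G.Param} (hcov : θ.cov = θ'.cov) :
    θ.totalEffect v c = θ'.totalEffect v c :=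
  (Param.totalEffect_and_lam_eq_of_cov_eq hcov (fun _ _ => G.dir_mem_an)
    (G.mem_disIn_self h.1) (fun _ hx => hx.1) (fun _ hx _ hy hxy => G.mem_disIn_of_adj hx hy hxy)
    (fun _ hx => h.eq_of_reach (fun _ _ => G.dir_mem_an) hx)).1 c .refl

/-- Removing a → b changes neither districts nor edges from a to other vertices, so the hypothesis
puts a outside the district of b and makes it a parent of no other vertex there. Fixability of b in
an(b) is automatic by acyclicity. -/
theorem lam_eq_of_notMem_mbIn [Fintype V] [DecidableEq V] {G : ADMG V} {a b : V}
    (hab : G.dir a b) (h : a ∉ (G.removeEdge a b).mbIn (G.an b) b) {θ θ' : G.Param}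
    (hcov : θ.cov = θ'.cov) : θ.lam a b = θ'.lam a b := by
  have hb : b ∈ G.an b := ReflTransGen.refl
  have ha : a ∈ G.an b := ReflTransGen.single hab
  have hne : a ≠ b := by
    rintro rfl
    exact G.acyclic a (.single hab)
  refine (Param.totalEffect_and_lam_eq_of_cov_eq hcov (fun _ _ => G.dir_mem_an)
    (G.mem_disIn_self hb) (fun _ hx => hx.1) (fun _ hx _ hy hxy => G.mem_disIn_of_adj hx hy hxy)
    (fun _ hx hbx => G.reach_antisymm hx.1 hbx)).2 a (fun ⟨_, _, had⟩ => h ⟨ha, hb, Or.inr ?_⟩)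
    fun y ⟨hy, _, hyd⟩ hyb hay => h ⟨ha, hb, Or.inl ⟨⟨y, hy⟩, hyd, hay, fun h => hyb h.2⟩⟩
  exact ⟨had, fun h => hne (congrArg Subtype.val h)⟩

theorem totalEffect_eq_of_chain [Fintype V] [DecidableEq V] {G : ADMG V} {b c : V} (hbc : b ≠ c)
    {n : ℕ} {v : Fin (n + 1) → V} (h0 : v 0 = b) (hlast : v (Fin.last n) = c)
    (hcut : ∀ i : Fin (n + 1), i ≠ 0 → i ≠ Fin.last n → G.IsCutVertexBetween b c (v i))
    (hfix : ∀ i : Fin n, G.FixableIn (G.an (v i.succ)) (v i.castSucc))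
    {θ θ' : G.Param} (hcov : θ.cov = θ'.cov) :
    θ.totalEffect b c = θ'.totalEffect b c := by
  have han (i : Fin (n + 1)) : v i ∈ G.an c := by
    induction i using Fin.reverseInduction with
    | last => exact hlast ▸ ReflTransGen.refl
    | cast i ih => exact ReflTransGen.trans (hfix i).1 ih
  have hmul (i : Fin n) (θ : G.Param) : θ.totalEffect b (v i.succ) =
      θ.totalEffect b (v i.castSucc) * θ.totalEffect (v i.castSucc) (v i.succ) := by
    -- The chain starts at b, which is not a cut vertex; there the factor is T_bb = 1.
    by_cases hi : i.castSucc = 0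
    · rw [hi, h0, θ.totalEffect_self, one_mul]
    · refine θ.totalEffect_eq_mul (or_iff_not_imp_left.2 fun hne => ?_)
      exact (hcut _ hi (Fin.castSucc_ne_last i)).not_reach_avoiding_of_mem_an hbc (hfix i).1 hne
        (han _)
  have key (i : Fin (n + 1)) : θ.totalEffect b (v i) = θ'.totalEffect b (v i) := by
    induction i using Fin.induction with
    | zero => rw [h0, θ.totalEffect_self, θ'.totalEffect_self]
    | succ i ih => rw [hmul i θ, hmul i θ', ih, (hfix i).totalEffect_eq hcov]
  rw [← hlast, key]

end ADMG

theorem mainTheorem12 {V : Type*} [Fintype V] [DecidableEq V] (G : ADMG V) (a b : V)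
    (hab : G.dir a b)
    (h_blanket : a ∉ (G.removeEdge a b).mbIn (G.an b) b)
    (h_chain : ∀ c ∈ G.de b \ {b}, ∃ (n : ℕ) (v : Fin (n + 1) → V),
      v 0 = b ∧ v (Fin.last n) = c ∧
      (∀ i : Fin (n + 1), i ≠ 0 → i ≠ Fin.last n → G.IsCutVertexBetween b c (v i)) ∧
      (∀ i : Fin n, G.FixableIn (G.an (v i.succ)) (v i.castSucc))) :
    IdentifiableGiven (fun θ : G.Param => (θ.removeEdge a b).cov)
      (fun θ : G.Param => θ.cov) := by
  intro θ θ' hcov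
  have htotal : θ.totalEffect b = θ'.totalEffect b := by
    funext c
    by_cases hc : c ∈ G.de b
    · by_cases hbc : b = c
      · rw [← hbc, θ.totalEffect_self, θ'.totalEffect_self]
      · obtain ⟨n, v, h0, hlast, hcut, hfix⟩ := h_chain c ⟨hc, Ne.symm hbc⟩
        exact ADMG.totalEffect_eq_of_chain hbc h0 hlast hcut hfix hcov
    · rw [θ.totalEffect_eq_zero hc, θ'.totalEffect_eq_zero hc]
  have hlam := ADMG.lam_eq_of_notMem_mbIn hab h_blanket hcov
  have hcov' : θ.cov = θ'.cov := hcov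
  change (θ.removeEdge a b).cov = (θ'.removeEdge a b).cov
  rw [θ.cov_removeEdge hab, θ'.cov_removeEdge hab, hlam, htotal, hcov']
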